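/- Let $f:\mathbb{R}^n\to\mathbb{R}$ be Lipschitz continuous with constant $L>0$ and differentiable, with gradient $f'$ Lipschitz continuous with constant $L_1>0$. Let $g:\mathbb{R}^n\to\mathbb{R}$ be continuously differentiable, let $Q=\{x\in\mathbb{R}^n: g(x)=0\}$, and suppose that $g'(x)\neq 0$ for all $x\in Q$ (so that $Q$ is a $C^1$ hypersurface without edge) and that $Q$ is proximally smooth with constant $R>0$, i.e. the distance function $\varrho_Q(x)=\inf_{a\in Q}\|x-a\|$ is continuously Fréchet differentiable on $\{x: 0<\varrho_Q(x)<R\}$. For $x\in Q$ let $P_{T_x}$ be the orthogonal projection onto the tangent subspace $T_x=\{v:(g'(x),v)=0\}$. Put $$t_0=\frac{1}{L_1+\frac{2L}{R}},\qquad q(s)=s-s^2\Big(\frac{L_1}{2}+\frac{L}{R}\Big),$$ and fix $t\in(0,2t_0)$. For $x\in Q$ put $z(x)=x-tP_{T_x}f'(x)$, $p(x)=g'(x)/\|g'(x)\|$, $h(x)=R-\sqrt{R^2-\|x-z(x)\|^2}$. (1) For every $x_0\in Q$ the segment $[z(x_0)-h(x_0)p(x_0),\,z(x_0)+h(x_0)p(x_0)]$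 meets $Q$ in exactly one point $x_1$, and $$f(x_1)-f(x_0)\le-\|P_{T_{x_0}}f'(x_0)\|^2\,q(t).$$ (2) The maximal value of $q$ on $\mathbb{R}$ is $q(t_0)=\tfrac12t_0$, and $q(s)>0$ for all $s\in(0,2t_0)$. (3) Consequently, for every $x_0\in Q$ the algorithm GPA2, which defines $x_{k+1}$ by $$\{x_{k+1}\}=[z(x_k)-h(x_k)p(x_k),\,z(x_k)+h(x_k)p(x_k)]\cap Q,\qquad k=0,1,2,\dots,$$ produces a unique infinite sequence $(x_k)$ in $Q$. (4) Let $\mu>0$ and $\beta\in\mathbb{R}$, suppose that the minimum $f_0=\min_Q f$ exists and that the Leżanski–Polyak–Łojasiewicz (LPL) condition $$\|P_{T_x}f'(x)\|^2\ge\mu\,(f(x)-f_0)\qquad\text{for all }x\in Q\text{ with }f(x)\le\beta$$ holds. Then there are $C>0$ and $\rho\in(0,1)$ such that for every initial point $x_0\in Q$ with $f(x_0)\le\beta$ the GPA2 sequence $(x_k)$ converges linearly to a minimum point of $f$ on $Q$: there is $x_*\in Q$ with $f(x_*)=f_0$ and $\|x_k-x_*\|\le C\rho^k$ for all $k\ge0$.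 -/

import Mathlib

open Set
open scoped NNReal

noncomputable section

/-- A closed set `Q` is proximally smooth with constant `R` if its distance function is
continuously Frechet differentiable on the (open) set `{x | 0 < dist (x, Q) < R}`. -/
def ProximallySmooth {n : ℕ} (Q : Set (EuclideanSpace ℝ (Fin n))) (R : ℝ) : Prop :=
  IsClosed Q ∧
    ContDiffOn ℝ 1 (fun x => Metric.infDist x Q)
      {x | 0 < Metric.infDist x Q ∧ Metric.infDist x Q < R}

/-- The hypersurface `{g = 0}`. -/
def zeroSurface {n : ℕ} (g : EuclideanSpace ℝ (Fin n) → ℝ) : Set (EuclideanSpace ℝ (Fin n)) :=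
  {x | g x = 0}

/-- The tangent subspace `T_x = {v | (g'(x), v) = 0}`. -/
abbrev tangentSubspace {n : ℕ} (g : EuclideanSpace ℝ (Fin n) → ℝ)
    (x : EuclideanSpace ℝ (Fin n)) : Submodule ℝ (EuclideanSpace ℝ (Fin n)) :=
  (Submodule.span ℝ {gradient g x})ᗮ

/-- The projected gradient `P_{T_x} f'(x)`. -/
def tangentGradient {n : ℕ} (f g : EuclideanSpace ℝ (Fin n) → ℝ)
    (x : EuclideanSpace ℝ (Fin n)) : EuclideanSpace ℝ (Fin n) :=
  (tangentSubspace g x).starProjection (gradient f x)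

/-- The tangent step `z = x - t P_{T_x} f'(x)`. -/
def tangentStep {n : ℕ} (f g : EuclideanSpace ℝ (Fin n) → ℝ) (t : ℝ)
    (x : EuclideanSpace ℝ (Fin n)) : EuclideanSpace ℝ (Fin n) :=
  x - t • tangentGradient f g x

/-- The unit normal `p = g'(x) / ‖g'(x)‖`. -/
def unitNormal {n : ℕ} (g : EuclideanSpace ℝ (Fin n) → ℝ)
    (x : EuclideanSpace ℝ (Fin n)) : EuclideanSpace ℝ (Fin n) :=
  ‖gradient g x‖⁻¹ • gradient g x

/-- The half-length `R - √(R² - ‖x - z‖²)` of the normal segment. -/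
def halfLength {n : ℕ} (f g : EuclideanSpace ℝ (Fin n) → ℝ) (R t : ℝ)
    (x : EuclideanSpace ℝ (Fin n)) : ℝ :=
  R - √(R ^ 2 - ‖x - tangentStep f g t x‖ ^ 2)

/-- The normal segment `[z - p h, z + p h]`, `h = R - √(R² - ‖x - z‖²)`. -/
def normalSegment {n : ℕ} (f g : EuclideanSpace ℝ (Fin n) → ℝ) (R t : ℝ)
    (x : EuclideanSpace ℝ (Fin n)) : Set (EuclideanSpace ℝ (Fin n)) :=
  segment ℝ
    (tangentStep f g t x - halfLength f g R t x • unitNormal g x)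
    (tangentStep f g t x + halfLength f g R t x • unitNormal g x)

/-- `y` is the next iterate after `x`: the normal segment at `x` meets the surface `{g = 0}`
in the single point `y`. -/
def IsGPA2Step {n : ℕ} (f g : EuclideanSpace ℝ (Fin n) → ℝ) (R t : ℝ)
    (x y : EuclideanSpace ℝ (Fin n)) : Prop :=
  normalSegment f g R t x ∩ zeroSurface g = {y}

/-- `x` is a run of the algorithm started at `x₀`. -/
def IsGPA2Run {n : ℕ} (f g : EuclideanSpace ℝ (Fin n) → ℝ) (R t : ℝ)
    (x₀ : EuclideanSpace ℝ (Fin n)) (x : ℕ → EuclideanSpace ℝ (Fin n)) : Prop :=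
  x 0 = x₀ ∧ ∀ k, IsGPA2Step f g R t (x k) (x (k + 1))

/-- The step size `t₀ = 1 / (L₁ + 2 L / R)`. -/
def optimalStep (L L₁ R : ℝ) : ℝ := 1 / (L₁ + 2 * L / R)

/-- `q(t) = t - t² (L₁ / 2 + L / R)`. -/
def stepGain (L L₁ R t : ℝ) : ℝ := t - t ^ 2 * (L₁ / 2 + L / R)

/-- The LPL condition (exponent two) with constant `μ` on the part of the surface `{g = 0}` where
`f ≤ β`, with `f₀` in the role of the minimum of `f` on the surface. -/
def LPLCondition {n : ℕ} (f g : EuclideanSpace ℝ (Fin n) → ℝ) (μ β f₀ : ℝ) : Prop :=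
  IsLeast (f '' zeroSurface g) f₀ ∧
    ∀ x ∈ zeroSurface g, f x ≤ β → μ * (f x - f₀) ≤ ‖tangentGradient f g x‖ ^ 2

end

/-! ### One-sided derivative tests. -/

section Preliminaries

open Filter Topology Metric

/-! Proximal smoothness is turned into a two-sided ball condition: at every `x ∈ Q` the open balls
of radius `R` centred at `x + R p(x)` and `x - R p(x)` lie in `{g > 0}` and `{g < 0}`
(`ProximallySmooth.pos_on_ball`, `ProximallySmooth.neg_on_ball`). This rests on
`infDist_normal_ray`: differentiability of the distance lets a normal ray realise the distance up to
length `R`.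

The ends of the normal segment lie in the two closed balls, so `g` changes sign along it. Positive
and negative balls at different points are disjoint, which makes the unit normals `1/R`-Lipschitz;
hence `g` has positive derivative along the segment at each of its zeros there, and the zero is
unique.

With `P` the projected gradient, the return to `Q` has length at most `h ≤ ‖x - z‖² / R` and costs
at most `(L / R) t² ‖P‖²`. Together with the descent lemma for the tangent step this gives the
decrease `q(t) ‖P‖²`. Under LPL the gap `f - f₀` then contracts geometrically, and step lengths are
controlled by its square root, so the iterates form a Cauchy sequence with a geometric rate. -/

theorem HasDerivAt.le_of_eventually_le_right {φ : ℝ → ℝ} {m a c : ℝ} (h : HasDerivAt φ m a)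
    (hc : ∀ᶠ s in 𝓝[>] a, φ s ≤ φ a + c * (s - a)) : m ≤ c := by
  have h1 : Tendsto (slope φ a) (𝓝[>] a) (𝓝 m) :=
    (hasDerivAt_iff_tendsto_slope.1 h).mono_left (nhdsWithin_mono _ fun s hs => ne_of_gt hs)
  refine le_of_tendsto h1 ?_
  filter_upwards [hc, self_mem_nhdsWithin] with s hs hsa
  rw [slope_def_field, div_le_iff₀ (sub_pos.2 hsa)]
  linarith

theorem HasDerivAt.ge_of_eventually_le_left {φ : ℝ → ℝ} {m a c : ℝ} (h : HasDerivAt φ m a)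
    (hc : ∀ᶠ s in 𝓝[<] a, φ s ≤ φ a + c * (s - a)) : c ≤ m := by
  have h1 : Tendsto (slope φ a) (𝓝[<] a) (𝓝 m) :=
    (hasDerivAt_iff_tendsto_slope.1 h).mono_left (nhdsWithin_mono _ fun s hs => ne_of_lt hs)
  refine ge_of_tendsto h1 ?_
  filter_upwards [hc, self_mem_nhdsWithin] with s hs hsa
  rw [slope_def_field, le_div_iff_of_neg (sub_neg.2 hsa)]
  linarith

/-! ### Distance function in the tube around a closed set. -/

section Tube

variable {E : Type*} [NormedAddCommGroup E] [InnerProductSpace ℝ E]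

theorem DifferentiableAt.hasDerivAt_line {F : E → ℝ} {z : E} (h : DifferentiableAt ℝ F z) (v : E) :
    HasDerivAt (fun s : ℝ => F (z + s • v)) (fderiv ℝ F z v) 0 :=
  h.hasFDerivAt.hasLineDerivAt v

variable [FiniteDimensional ℝ E] {Q : Set E}

/-- Away from `Q` the distance function increases at unit speed in some direction. -/
theorem exists_unit_one_le_fderiv_infDist (hQ : IsClosed Q) (hne : Q.Nonempty) {z : E}
    (hz : 0 < infDist z Q) (hd : DifferentiableAt ℝ (fun x => infDist x Q) z) :
    ∃ v : E, ‖v‖ = 1 ∧ 1 ≤ fderiv ℝ (fun x => infDist x Q) z v := by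
  obtain ⟨b, hb, hzb⟩ := hQ.exists_infDist_eq_dist hne z
  have hn : ‖z - b‖ = infDist z Q := by rw [hzb, dist_eq_norm]
  have hn0 : 0 < ‖z - b‖ := hn ▸ hz
  refine ⟨‖z - b‖⁻¹ • (z - b), ?_, ?_⟩
  · rw [norm_smul, norm_inv, norm_norm, inv_mul_cancel₀ hn0.ne']
  · refine (hd.hasDerivAt_line _).ge_of_eventually_le_left ?_
    have : ∀ᶠ s in 𝓝[<] (0 : ℝ), -‖z - b‖ < s :=
      mem_nhdsWithin_of_mem_nhds (Ioi_mem_nhds (by linarith))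
    filter_upwards [this] with s hs
    have h1 : infDist (z + s • ‖z - b‖⁻¹ • (z - b)) Q ≤ _ := infDist_le_dist_of_mem hb
    have h2 : z + s • ‖z - b‖⁻¹ • (z - b) - b = (1 + s * ‖z - b‖⁻¹) • (z - b) := by
      module
    have h3 : 0 ≤ 1 + s * ‖z - b‖⁻¹ := by
      rw [← div_eq_mul_inv]
      have : -1 ≤ s / ‖z - b‖ := by rw [le_div_iff₀ hn0]; linarith
      linarith
    rw [dist_eq_norm, h2, norm_smul, Real.norm_of_nonneg h3] at h1
    have h4 : (1 + s * ‖z - b‖⁻¹) * ‖z - b‖ = ‖z - b‖ + s := by field_simp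
    simp only [zero_smul, add_zero]
    linarith

/-- Maximise the distance to `Q` minus the penalty `(1 - ε) * dist w y` over the ball. At an
interior maximiser every directional derivative of the distance would be at most `1 - ε`, against
the direction of slope at least `1`; so the maximiser is on the sphere. -/
theorem exists_dist_eq_infDist_ge {R : ℝ} (hQ : IsClosed Q) (hne : Q.Nonempty)
    (hd : ∀ x, 0 < infDist x Q → infDist x Q < R → DifferentiableAt ℝ (fun x => infDist x Q) x)
    {y : E} (hy : 0 < infDist y Q) {τ ε : ℝ} (hτ : 0 ≤ τ) (hτR : infDist y Q + τ < R)
    (hε : 0 < ε) (hε1 : ε ≤ 1) :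
    ∃ z ∈ closedBall y τ, infDist y Q + (1 - ε) * τ ≤ infDist z Q := by
  have hcont : Continuous fun x : E => infDist x Q := continuous_infDist_pt Q
  obtain ⟨z, hz, hmax⟩ := (isCompact_closedBall y τ).exists_isMaxOn
    ⟨y, mem_closedBall_self hτ⟩
    (f := fun w => infDist w Q - (1 - ε) * dist w y) (by fun_prop)
  refine ⟨z, hz, ?_⟩
  have h1 := hmax (mem_closedBall_self hτ)
  simp only [mem_ofPred_eq, dist_self, mul_zero, sub_zero] at h1
  rcases (mem_closedBall.1 hz).eq_or_lt with h | h
  · rw [h] at h1; linarith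
  · exfalso
    have h2 : 0 ≤ (1 - ε) * dist z y := mul_nonneg (by linarith) dist_nonneg
    have h3 : infDist z Q ≤ infDist y Q + dist z y := infDist_le_infDist_add_dist
    have hzd := hd z (by linarith) (by linarith)
    obtain ⟨v, hv, hv1⟩ := exists_unit_one_le_fderiv_infDist hQ hne (by linarith) hzd
    have h4 : fderiv ℝ (fun x => infDist x Q) z v ≤ 1 - ε := by
      refine (hzd.hasDerivAt_line v).le_of_eventually_le_right ?_
      have : ∀ᶠ s in 𝓝[>] (0 : ℝ), s < τ - dist z y :=
        mem_nhdsWithin_of_mem_nhds (Iio_mem_nhds (by linarith))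
      filter_upwards [this, self_mem_nhdsWithin] with s hs hs0
      have h5 : dist (z + s • v) y ≤ s + dist z y := by
        refine (dist_triangle _ z _).trans ?_
        simp [dist_eq_norm, norm_smul, hv, abs_of_pos (mem_Ioi.1 hs0)]
      have h6 := hmax (mem_closedBall.2 (show dist (z + s • v) y ≤ τ by linarith))
      have h7 := mul_le_mul_of_nonneg_left h5 (sub_nonneg.2 hε1)
      simp only [mem_ofPred_eq] at h6
      simp only [zero_smul, add_zero]
      linarith
    linarith

/-- If the distance to `Q` is differentiable in the tube of radius `R`, then along a normal ray
the distance to `Q` is the arc length up to `R`. -/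
theorem infDist_normal_ray {R : ℝ} (hQ : IsClosed Q)
    (hd : ∀ x, 0 < infDist x Q → infDist x Q < R → DifferentiableAt ℝ (fun x => infDist x Q) x)
    {y a : E} (hy : 0 < infDist y Q) (hyR : infDist y Q < R) (ha : a ∈ Q)
    (hya : infDist y Q = dist y a) :
    infDist (a + (R / infDist y Q) • (y - a)) Q = R := by
  have hne : Q.Nonempty := ⟨a, ha⟩
  have hcont : Continuous fun x : E => infDist x Q := continuous_infDist_pt Q
  have key : ∀ s ∈ Ioo (infDist y Q) R, infDist (a + (s / infDist y Q) • (y - a)) Q = s := by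
    intro s hs
    set r := infDist y Q with hr
    have hτ : 0 < s - r := sub_pos.2 hs.1
    obtain ⟨z, hz, hmax⟩ := (isCompact_closedBall y (s - r)).exists_isMaxOn
      ⟨y, mem_closedBall_self hτ.le⟩ hcont.continuousOn
    -- The maximiser does not depend on `ε`, so the loss `ε * (s - r)` can be made smaller than any
    -- `δ`.
    have h1 : s ≤ infDist z Q := by
      refine le_of_forall_pos_le_add fun δ hδ => ?_
      have hε : 0 < min 1 (δ / (s - r)) := lt_min one_pos (div_pos hδ hτ)
      obtain ⟨w, hw, hw1⟩ := exists_dist_eq_infDist_ge hQ hne hd hy hτ.le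
        (by linarith [hs.2]) hε (min_le_left _ _)
      have h2 : infDist w Q ≤ infDist z Q := hmax hw
      have h3 : min 1 (δ / (s - r)) * (s - r) ≤ δ :=
        (mul_le_mul_of_nonneg_right (min_le_right _ _) hτ.le).trans_eq (div_mul_cancel₀ _ hτ.ne')
      linarith
    have h2 : ‖z - y‖ ≤ s - r := by rw [← dist_eq_norm]; exact hz
    have h3 : ‖y - a‖ = r := by rw [← dist_eq_norm, ← hya]
    have h4 : infDist z Q ≤ ‖(z - y) + (y - a)‖ := by
      rw [sub_add_sub_cancel, ← dist_eq_norm]; exact infDist_le_dist_of_mem ha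
    have h5 := norm_add_le (z - y) (y - a)
    have h6 : ‖z - y‖ = s - r := by linarith
    -- Equality in the triangle inequality forces `z` onto the ray from `a` through `y`.
    have h7 : ‖z - y‖ • (y - a) = ‖y - a‖ • (z - y) :=
      sameRay_iff_norm_smul_eq.1 (sameRay_iff_norm_add.2 (by linarith))
    rw [h6, h3] at h7
    have h8 : z = a + (s / r) • (y - a) := by
      have h9 : z - y = r⁻¹ • (s - r) • (y - a) := by rw [h7, inv_smul_smul₀ hy.ne']
      have h10 : s / r = r⁻¹ * (s - r) + 1 := by field_simp; ring
      rw [h10, add_smul, mul_smul, ← h9]; module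
    rw [← h8]; linarith
  -- The end value `s = R`, where differentiability is not assumed, is reached by continuity.
  have hclosed : IsClosed {s : ℝ | infDist (a + (s / infDist y Q) • (y - a)) Q = s} :=
    isClosed_eq (hcont.comp (by fun_prop)) continuous_id
  have h := closure_minimal (fun s hs => key s hs) hclosed
  rw [closure_Ioo hyR.ne] at h
  exact h (right_mem_Icc.2 hyR.le)

end Tube

/-! ### Supporting balls and normals of the hypersurface. -/

section Surface

variable {n : ℕ} {g : EuclideanSpace ℝ (Fin n) → ℝ}

theorem hasDerivAt_line_gradient {F : EuclideanSpace ℝ (Fin n) → ℝ} (hF : Differentiable ℝ F)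
    (x v : EuclideanSpace ℝ (Fin n)) (s : ℝ) :
    HasDerivAt (fun s : ℝ => F (x + s • v)) (inner ℝ (gradient F (x + s • v)) v) s := by
  rw [inner_gradient_left]
  have h1 : HasDerivAt (fun s : ℝ => x + s • v) v s := by
    simpa using ((hasDerivAt_id s).smul_const v).const_add x
  exact (hF (x + s • v)).hasFDerivAt.comp_hasDerivAt s h1

theorem eventually_pos_of_inner_gradient_pos (hg : Differentiable ℝ g)
    {x v : EuclideanSpace ℝ (Fin n)} (hx : g x = 0) (hv : 0 < inner ℝ (gradient g x) v) :
    ∀ᶠ s in 𝓝[>] (0 : ℝ), 0 < g (x + s • v) := by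
  have h := hasDerivAt_line_gradient hg x v 0
  rw [zero_smul, add_zero] at h
  have h1 := (hasDerivAt_iff_tendsto_slope.1 h).mono_left
    (nhdsWithin_mono (0 : ℝ) fun s (hs : s ∈ Ioi 0) => ne_of_gt hs)
  filter_upwards [h1.eventually (lt_mem_nhds hv), self_mem_nhdsWithin] with s hs hs0
  rw [slope_def_field] at hs
  simpa [hx, div_pos_iff_of_pos_right (mem_Ioi.1 hs0)] using hs

theorem pos_on_ball_of_disjoint (hg : Continuous g) {c w : EuclideanSpace ℝ (Fin n)} {r : ℝ}
    (h : Disjoint (ball c r) (zeroSurface g)) (hw : w ∈ ball c r) (hgw : 0 < g w)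
    {y : EuclideanSpace ℝ (Fin n)} (hy : y ∈ ball c r) : 0 < g y := by
  by_contra hneg
  obtain ⟨u, hu, hu0⟩ := (convex_ball c r).isPreconnected.intermediate_value hy hw
    hg.continuousOn ⟨not_lt.1 hneg, hgw.le⟩
  exact disjoint_left.1 h hu hu0

/-- The centre of a ball on which `g` is positive and whose boundary touches the surface at `a`
lies on the normal line at `a`. -/
theorem sub_eq_smul_unitNormal_of_pos_on_ball (hg : Differentiable ℝ g)
    {a c : EuclideanSpace ℝ (Fin n)} {r : ℝ} (hr : 0 < r) (hca : ‖c - a‖ = r) (ha : g a = 0)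
    (hga : gradient g a ≠ 0) (hpos : ∀ y ∈ ball c r, 0 < g y) :
    c - a = r • unitNormal g a := by
  set u := c - a with hu
  set G := gradient g a with hG
  -- Directions with `0 < inner ℝ w u` enter the ball, where `g` exceeds its value `0` at `a`.
  have h1 : ∀ w, 0 < inner ℝ w u → 0 ≤ inner ℝ G w := by
    intro w hw
    have hder := (hasDerivAt_line_gradient hg a w 0).neg
    rw [zero_smul, add_zero] at hder
    have := hder.le_of_eventually_le_right (c := 0) ?_
    · linarith
    have hlim : Tendsto (fun s : ℝ => s * ‖w‖ ^ 2) (𝓝[>] 0) (𝓝 0) := by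
      have : Continuous fun s : ℝ => s * ‖w‖ ^ 2 := by fun_prop
      simpa using (this.tendsto 0).mono_left nhdsWithin_le_nhds
    filter_upwards [hlim.eventually (gt_mem_nhds (show 0 < 2 * inner ℝ w u by linarith)),
      self_mem_nhdsWithin] with s hs hs0
    have hmem : a + s • w ∈ ball c r := by
      rw [mem_ball, dist_eq_norm, show a + s • w - c = s • w - u by rw [hu]; abel]
      refine lt_of_pow_lt_pow_left₀ 2 hr.le ?_
      rw [norm_sub_sq_real, hca, inner_smul_left, norm_smul, mul_pow, Real.norm_eq_abs, sq_abs]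
      have := mul_lt_mul_of_pos_left hs (mem_Ioi.1 hs0)
      simp only [conj_trivial]
      nlinarith
    have := hpos _ hmem
    simp only [Pi.neg_apply, zero_smul, add_zero, ha]
    linarith
  have huu : inner ℝ u u = r ^ 2 := by rw [real_inner_self_eq_norm_sq, hca]
  have h2 : 0 ≤ inner ℝ G u := h1 u (by rw [huu]; positivity)
  have h3 : ∀ w, inner ℝ w u = 0 → 0 ≤ inner ℝ G w := by
    intro w hw
    have hlim : Tendsto (fun e : ℝ => inner ℝ G w + e * inner ℝ G u) (𝓝[>] 0)
        (𝓝 (inner ℝ G w)) := by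
      have : Continuous fun e : ℝ => inner ℝ G w + e * inner ℝ G u := by fun_prop
      simpa using (this.tendsto 0).mono_left nhdsWithin_le_nhds
    refine ge_of_tendsto hlim ?_
    filter_upwards [self_mem_nhdsWithin] with e he
    have := h1 (w + e • u) (by
      rw [inner_add_left, hw, inner_smul_left, huu]
      have := mem_Ioi.1 he
      simp only [conj_trivial]; positivity)
    rwa [inner_add_right, inner_smul_right] at this
  have h4 : ‖G‖ ^ 2 * r ^ 2 ≤ inner ℝ G u ^ 2 := by
    -- Minus the component of `G` orthogonal to `u`: nonnegativity of its product with `G` yields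
    -- the equality case of Cauchy–Schwarz.
    have := h3 ((inner ℝ G u / r ^ 2) • u - G) (by
      rw [inner_sub_left, inner_smul_left, huu]
      simp only [conj_trivial]; field_simp; ring)
    rw [inner_sub_right, inner_smul_right, real_inner_self_eq_norm_sq] at this
    have h5 := mul_le_mul_of_nonneg_right (sub_nonneg.1 this) (sq_nonneg r)
    have h6 : inner ℝ G u / r ^ 2 * inner ℝ G u * r ^ 2 = inner ℝ G u ^ 2 := by field_simp
    linarith
  have h5 : inner ℝ G u = ‖G‖ * ‖u‖ := by
    refine le_antisymm (real_inner_le_norm _ _) ?_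
    rw [hca]
    exact le_of_sq_le_sq (by rw [mul_pow]; exact h4) h2
  rw [inner_eq_norm_mul_iff_real, hca] at h5
  have hn : ‖G‖ ≠ 0 := norm_ne_zero_iff.2 hga
  rw [unitNormal, smul_comm, ← hG, h5, inv_smul_smul₀ hn]

theorem continuous_gradient (hg : ContDiff ℝ 1 g) : Continuous (gradient g) :=
  (InnerProductSpace.toDual ℝ _).symm.continuous.comp (hg.continuous_fderiv one_ne_zero)

theorem norm_unitNormal {x : EuclideanSpace ℝ (Fin n)} (hx : gradient g x ≠ 0) :
    ‖unitNormal g x‖ = 1 := by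
  rw [unitNormal, norm_smul, norm_inv, norm_norm, inv_mul_cancel₀ (norm_ne_zero_iff.2 hx)]

theorem gradient_eq_smul_unitNormal {x : EuclideanSpace ℝ (Fin n)} (hx : gradient g x ≠ 0) :
    gradient g x = ‖gradient g x‖ • unitNormal g x := by
  rw [unitNormal, smul_inv_smul₀ (norm_ne_zero_iff.2 hx)]

theorem inner_gradient_unitNormal_pos {x : EuclideanSpace ℝ (Fin n)} (hx : gradient g x ≠ 0) :
    0 < inner ℝ (gradient g x) (unitNormal g x) := by
  have := norm_pos_iff.2 hx
  rw [unitNormal, inner_smul_right, real_inner_self_eq_norm_sq]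
  positivity

variable {R : ℝ}

/-- It is not known at first that `x` is the nearest point of anything off `Q`. But the foot `a` of
`x + s p(x)` has the property, since the normal ray there is known, and lies within `2 s` of `x`;
letting `s → 0`, continuity of the unit normal carries it to `x`. -/
theorem ProximallySmooth.infDist_add_smul_unitNormal (hR : 0 < R) (hg : ContDiff ℝ 1 g)
    (hg' : ∀ x ∈ zeroSurface g, gradient g x ≠ 0) (hQ : ProximallySmooth (zeroSurface g) R)
    {x : EuclideanSpace ℝ (Fin n)} (hx : x ∈ zeroSurface g) :
    infDist (x + R • unitNormal g x) (zeroSurface g) = R := by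
  have hgd : Differentiable ℝ g := hg.differentiable one_ne_zero
  have hopen : IsOpen {x | 0 < infDist x (zeroSurface g) ∧ infDist x (zeroSurface g) < R} :=
    (isOpen_lt continuous_const (continuous_infDist_pt _)).inter
      (isOpen_lt (continuous_infDist_pt _) continuous_const)
  have hd : ∀ x, 0 < infDist x (zeroSurface g) → infDist x (zeroSurface g) < R →
      DifferentiableAt ℝ (fun x => infDist x (zeroSurface g)) x := fun x h1 h2 =>
    (hQ.2.differentiableOn one_ne_zero).differentiableAt (hopen.mem_nhds ⟨h1, h2⟩)
  have hcont : ContinuousAt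
      (fun a => infDist (a + R • unitNormal g a) (zeroSurface g)) x := by
    refine (continuous_infDist_pt _).continuousAt.comp ?_
    have h1 : ContinuousAt (gradient g) x := (continuous_gradient hg).continuousAt
    exact continuousAt_id.add
      (((h1.norm.inv₀ (norm_ne_zero_iff.2 (hg' x hx))).smul h1).const_smul R)
  have hcl : x ∈ closure {a | infDist (a + R • unitNormal g a) (zeroSurface g) = R} := by
    rw [Metric.mem_closure_iff]
    intro ε hε
    have hsmall : ∀ᶠ s in 𝓝[>] (0 : ℝ), s < min R (ε / 2) :=
      mem_nhdsWithin_of_mem_nhds (Iio_mem_nhds (by positivity))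
    obtain ⟨s, hpos, hs, hs0⟩ := ((eventually_pos_of_inner_gradient_pos hgd hx
      (inner_gradient_unitNormal_pos (hg' x hx))).and
      (hsmall.and self_mem_nhdsWithin)).exists
    have hs0 : 0 < s := hs0
    set y := x + s • unitNormal g x with hy
    have hyx : dist y x = s := by
      rw [dist_eq_norm, hy, add_sub_cancel_left, norm_smul, norm_unitNormal (hg' x hx), mul_one,
        Real.norm_of_nonneg hs0.le]
    have hyQ : y ∉ zeroSurface g := fun h => hpos.ne' h
    have hd0 : 0 < infDist y (zeroSurface g) :=
      (hQ.1.notMem_iff_infDist_pos ⟨x, hx⟩).1 hyQ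
    have hds : infDist y (zeroSurface g) ≤ s := (infDist_le_dist_of_mem hx).trans_eq hyx
    obtain ⟨a, ha, hya⟩ := hQ.1.exists_infDist_eq_dist ⟨x, hx⟩ y
    refine ⟨a, ?_, ?_⟩
    · have hn := sub_eq_smul_unitNormal_of_pos_on_ball hgd hd0
        (by rw [hya, dist_eq_norm]) ha (hg' a ha)
        (fun w hw => pos_on_ball_of_disjoint hg.continuous disjoint_ball_infDist
          (mem_ball_self hd0) hpos hw)
      have h := infDist_normal_ray hQ.1 hd hd0 (hds.trans_lt (hs.trans_le (min_le_left _ _)))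
        ha hya
      rwa [hn, smul_smul, div_mul_cancel₀ _ hd0.ne'] at h
    · have h1 := dist_triangle x y a
      rw [dist_comm x y, hyx, ← hya] at h1
      have := min_le_right R (ε / 2)
      linarith
  have := hcont.continuousWithinAt.mem_closure hcl
    (show MapsTo _ _ ({R} : Set ℝ) from fun a ha => ha)
  simpa using this

/-- The supporting ball in the direction of the unit normal lies in `{g > 0}`. -/
theorem ProximallySmooth.pos_on_ball (hR : 0 < R) (hg : ContDiff ℝ 1 g)
    (hg' : ∀ x ∈ zeroSurface g, gradient g x ≠ 0) (hQ : ProximallySmooth (zeroSurface g) R)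
    {x : EuclideanSpace ℝ (Fin n)} (hx : x ∈ zeroSurface g) :
    ∀ y ∈ ball (x + R • unitNormal g x) R, 0 < g y := by
  have hinf := hQ.infDist_add_smul_unitNormal hR hg hg' hx
  have hdis : Disjoint (ball (x + R • unitNormal g x) R) (zeroSurface g) := by
    have h : Disjoint (ball (x + R • unitNormal g x)
      (infDist (x + R • unitNormal g x) (zeroSurface g))) (zeroSurface g) := disjoint_ball_infDist
    rwa [hinf] at h
  have hsmall : ∀ᶠ s in 𝓝[>] (0 : ℝ), s < R := mem_nhdsWithin_of_mem_nhds (Iio_mem_nhds hR)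
  obtain ⟨s, hpos, hs, hs0⟩ := ((eventually_pos_of_inner_gradient_pos
    (hg.differentiable one_ne_zero) hx (inner_gradient_unitNormal_pos (hg' x hx))).and
      (hsmall.and self_mem_nhdsWithin)).exists
  have hs0 : 0 < s := hs0
  refine fun y hy => pos_on_ball_of_disjoint hg.continuous hdis ?_ hpos hy
  rw [mem_ball, dist_eq_norm, add_sub_add_left_eq_sub, ← sub_smul, norm_smul,
    norm_unitNormal (hg' x hx), mul_one, Real.norm_eq_abs, abs_sub_comm,
    abs_of_pos (sub_pos.2 hs)]
  linarith

theorem gradient_neg_fun (x : EuclideanSpace ℝ (Fin n)) :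
    gradient (fun y => -g y) x = -gradient g x := by
  simp [gradient, fderiv_fun_neg]

/-- The supporting ball in the direction opposite to the unit normal lies in `{g < 0}`. -/
theorem ProximallySmooth.neg_on_ball (hR : 0 < R) (hg : ContDiff ℝ 1 g)
    (hg' : ∀ x ∈ zeroSurface g, gradient g x ≠ 0) (hQ : ProximallySmooth (zeroSurface g) R)
    {x : EuclideanSpace ℝ (Fin n)} (hx : x ∈ zeroSurface g) :
    ∀ y ∈ ball (x - R • unitNormal g x) R, g y < 0 := by
  have hz : zeroSurface (fun y => -g y) = zeroSurface g := by
    ext y; simp [zeroSurface]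
  have hu : unitNormal (fun y => -g y) x = -unitNormal g x := by
    simp [unitNormal, gradient_neg_fun]
  have h := ProximallySmooth.pos_on_ball (g := fun y => -g y) hR hg.neg
    (fun y hy => by rw [gradient_neg_fun]; exact neg_ne_zero.2 (hg' y (hz ▸ hy)))
    (hz.symm ▸ hQ) (hz.symm ▸ hx)
  intro y hy
  rw [hu, smul_neg, ← sub_eq_add_neg] at h
  have := h y hy
  linarith

/-- The unit normals of a proximally smooth hypersurface are Lipschitz with constant `1 / R`. -/
theorem ProximallySmooth.norm_unitNormal_sub_le (hR : 0 < R) (hg : ContDiff ℝ 1 g)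
    (hg' : ∀ x ∈ zeroSurface g, gradient g x ≠ 0) (hQ : ProximallySmooth (zeroSurface g) R)
    {x y : EuclideanSpace ℝ (Fin n)} (hx : x ∈ zeroSurface g) (hy : y ∈ zeroSurface g) :
    R * ‖unitNormal g x - unitNormal g y‖ ≤ ‖x - y‖ := by
  have key : ∀ x ∈ zeroSurface g, ∀ y ∈ zeroSurface g,
      2 * R ≤ ‖(x - y) + R • (unitNormal g x + unitNormal g y)‖ := by
    intro x hx y hy
    have hdis : Disjoint (ball (x + R • unitNormal g x) R) (ball (y - R • unitNormal g y) R) :=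
      disjoint_left.2 fun w h1 h2 =>
        (hQ.pos_on_ball hR hg hg' hx w h1).not_gt (hQ.neg_on_ball hR hg hg' hy w h2)
    have := (disjoint_ball_ball_iff hR hR).1 hdis
    rw [dist_eq_norm] at this
    rw [show x - y + R • (unitNormal g x + unitNormal g y) =
      x + R • unitNormal g x - (y - R • unitNormal g y) by module]
    linarith
  have h1 := key x hx y hy
  have h2 := key y hy x hx
  have h2' : 2 * R ≤ ‖(x - y) - R • (unitNormal g x + unitNormal g y)‖ := by
    rw [← norm_neg, show -(x - y - R • (unitNormal g x + unitNormal g y)) =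
      y - x + R • (unitNormal g y + unitNormal g x) by module]
    exact h2
  -- Adding the squares of the two bounds `2 * R ≤ …` cancels the mixed term; the second
  -- parallelogram law trades the sum of the normals for their difference.
  have h3 := parallelogram_law_with_norm ℝ (x - y) (R • (unitNormal g x + unitNormal g y))
  have h4 := parallelogram_law_with_norm ℝ (unitNormal g x) (unitNormal g y)
  rw [norm_smul, Real.norm_of_nonneg hR.le] at h3
  rw [norm_unitNormal (hg' x hx), norm_unitNormal (hg' y hy)] at h4
  have h5 := mul_self_le_mul_self (by positivity) h1
  have h6 := mul_self_le_mul_self (by positivity) h2'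
  refine le_of_sq_le_sq ?_ (norm_nonneg _)
  have h7 : R ^ 2 * (‖unitNormal g x + unitNormal g y‖ ^ 2 +
      ‖unitNormal g x - unitNormal g y‖ ^ 2) = R ^ 2 * 4 := by
    rw [h4]; norm_num
  nlinarith

end Surface

/-- After one zero `φ` cannot become negative, so at a later zero it would arrive from nonnegative
values, with derivative at most `0`. -/
theorem eq_of_zero_of_deriv_pos_at_zeros {φ φ' : ℝ → ℝ} (hφ : ∀ s, HasDerivAt φ (φ' s) s)
    {a b : ℝ} (hpos : ∀ s ∈ Icc a b, φ s = 0 → 0 < φ' s) {s₁ s₂ : ℝ} (hs₁ : s₁ ∈ Icc a b)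
    (hs₂ : s₂ ∈ Icc a b) (h₁ : φ s₁ = 0) (h₂ : φ s₂ = 0) : s₁ = s₂ := by
  wlog hlt : s₁ < s₂ generalizing s₁ s₂
  · rcases (not_lt.1 hlt).eq_or_lt with h | h
    · exact h.symm
    · exact (this hs₂ hs₁ h₂ h₁ h).symm
  exfalso
  have hcont : Continuous φ := continuous_iff_continuousAt.2 fun s => (hφ s).continuousAt
  have hnonneg : ∀ s ∈ Icc s₁ s₂, 0 ≤ φ s := by
    intro s hs
    -- Here `φ` plays the upper barrier and the constant `0` the function kept below it.
    refine image_le_of_deriv_right_lt_deriv_boundary' (f := fun _ => 0) (f' := fun _ => 0)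
      continuousOn_const (fun x _ => hasDerivWithinAt_const _ _ _) h₁.ge hcont.continuousOn
      (fun x _ => (hφ x).hasDerivWithinAt) (fun x hx h => ?_) hs
    exact hpos x ⟨hs₁.1.trans hx.1, hx.2.le.trans hs₂.2⟩ h.symm
  have := (hφ s₂).neg.ge_of_eventually_le_left (c := 0) (by
    have : ∀ᶠ s in 𝓝[<] s₂, s₁ < s := mem_nhdsWithin_of_mem_nhds (Ioi_mem_nhds hlt)
    filter_upwards [this, self_mem_nhdsWithin] with s hs hs2
    have := hnonneg s ⟨hs.le, (mem_Iio.1 hs2).le⟩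
    simp only [Pi.neg_apply, h₂]
    linarith)
  linarith [hpos s₂ hs₂ h₂]

/-! ### One step of the algorithm, and convergence. -/

section Step

variable {n : ℕ} {f g : EuclideanSpace ℝ (Fin n) → ℝ} {R : ℝ}

/-- The descent lemma for functions with Lipschitz gradient. -/
theorem le_of_lipschitzWith_gradient {L₁ : ℝ≥0} (hf : Differentiable ℝ f)
    (hL₁ : LipschitzWith L₁ (gradient f)) (x v : EuclideanSpace ℝ (Fin n)) :
    f (x + v) ≤ f x + inner ℝ (gradient f x) v + L₁ / 2 * ‖v‖ ^ 2 := by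
  have hder := hasDerivAt_line_gradient hf x v
  have hB : ∀ s : ℝ, HasDerivAt
      (fun s : ℝ => f x + s * inner ℝ (gradient f x) v + L₁ / 2 * ‖v‖ ^ 2 * s ^ 2)
      (inner ℝ (gradient f x) v + L₁ * ‖v‖ ^ 2 * s) s := by
    intro s
    convert! (((hasDerivAt_id s).mul_const (inner ℝ (gradient f x) v)).const_add (f x)).add
      (((hasDerivAt_id s).pow 2).const_mul (L₁ / 2 * ‖v‖ ^ 2)) using 1
    simp only [id]
    ring
  have hfc : Continuous fun s : ℝ => f (x + s • v) :=
    continuous_iff_continuousAt.2 fun s => (hder s).continuousAt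
  have h := image_le_of_deriv_right_le_deriv_boundary (a := 0) (b := 1) hfc.continuousOn
    (fun s _ => (hder s).hasDerivWithinAt) (by simp)
    (continuous_iff_continuousAt.2 fun s => (hB s).continuousAt).continuousOn
    (fun s _ => (hB s).hasDerivWithinAt) (fun s hs => ?_) (right_mem_Icc.2 zero_le_one)
  · simpa using h
  · have h1 : inner ℝ (gradient f (x + s • v) - gradient f x) v ≤ L₁ * ‖v‖ ^ 2 * s := by
      refine (real_inner_le_norm _ _).trans ?_
      have h2 := hL₁.norm_sub_le (x + s • v) x
      rw [add_sub_cancel_left, norm_smul, Real.norm_of_nonneg hs.1] at h2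
      calc _ ≤ (L₁ * (s * ‖v‖)) * ‖v‖ := mul_le_mul_of_nonneg_right h2 (norm_nonneg _)
        _ = _ := by ring
    rw [inner_sub_left] at h1
    linarith

theorem norm_gradient_le_of_lipschitzWith {L : ℝ≥0} (hL : LipschitzWith L f)
    (x : EuclideanSpace ℝ (Fin n)) : ‖gradient f x‖ ≤ L := by
  rw [gradient, LinearIsometryEquiv.norm_map]
  exact norm_fderiv_le_of_lipschitz ℝ hL

theorem norm_sq_add_smul_of_inner_eq_zero {p v : EuclideanSpace ℝ (Fin n)} (hp : ‖p‖ = 1)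
    (hv : inner ℝ p v = 0) (s : ℝ) : ‖v + s • p‖ ^ 2 = ‖v‖ ^ 2 + s ^ 2 := by
  rw [norm_add_sq_real, inner_smul_right, real_inner_comm, hv, norm_smul, hp, mul_one,
    Real.norm_eq_abs, sq_abs]
  ring

/-- The relation `hh` says `‖v‖² + (R - h)² = R²`: the ends of the segment are on the two supporting
spheres at `x`. -/
theorem ProximallySmooth.existsUnique_zero_on_normal_segment (hR : 0 < R) (hg : ContDiff ℝ 1 g)
    (hg' : ∀ x ∈ zeroSurface g, gradient g x ≠ 0) (hQ : ProximallySmooth (zeroSurface g) R)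
    {x v : EuclideanSpace ℝ (Fin n)} (hx : x ∈ zeroSurface g)
    (hv : inner ℝ (unitNormal g x) v = 0) {h : ℝ} (h0 : 0 ≤ h) (hhR : h < R)
    (hh : ‖v‖ ^ 2 = 2 * R * h - h ^ 2) :
    ∃ s ∈ Icc (-h) h, g (x + v + s • unitNormal g x) = 0 ∧
      ∀ s' ∈ Icc (-h) h, g (x + v + s' • unitNormal g x) = 0 → s' = s := by
  set p := unitNormal g x with hp
  have hp1 : ‖p‖ = 1 := norm_unitNormal (hg' x hx)
  have hgd : Differentiable ℝ g := hg.differentiable one_ne_zero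
  have hder := hasDerivAt_line_gradient hgd (x + v) p
  have hcont : Continuous fun s : ℝ => g (x + v + s • p) :=
    hg.continuous.comp (by fun_prop)
  have hright : 0 ≤ g (x + v + h • p) := by
    have hcl : IsClosed {y | 0 ≤ g y} := isClosed_le continuous_const hg.continuous
    have hsub := closure_minimal (fun y hy => (hQ.pos_on_ball hR hg hg' hx y hy).le) hcl
    rw [closure_ball _ hR.ne'] at hsub
    refine hsub ?_
    rw [mem_closedBall, dist_eq_norm, show x + v + h • p - (x + R • unitNormal g x) =
      v + (h - R) • p by rw [hp]; module]
    refine le_of_sq_le_sq ?_ hR.le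
    rw [norm_sq_add_smul_of_inner_eq_zero hp1 hv, hh]
    nlinarith
  have hleft : g (x + v + (-h) • p) ≤ 0 := by
    have hcl : IsClosed {y | g y ≤ 0} := isClosed_le hg.continuous continuous_const
    have hsub := closure_minimal (fun y hy => (hQ.neg_on_ball hR hg hg' hx y hy).le) hcl
    rw [closure_ball _ hR.ne'] at hsub
    refine hsub ?_
    rw [mem_closedBall, dist_eq_norm, show x + v + (-h) • p - (x - R • unitNormal g x) =
      v + (R - h) • p by rw [hp]; module]
    refine le_of_sq_le_sq ?_ hR.le
    rw [norm_sq_add_smul_of_inner_eq_zero hp1 hv, hh]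
    nlinarith
  obtain ⟨s, hs, hs0⟩ := intermediate_value_Icc (show -h ≤ h by linarith) hcont.continuousOn
    ⟨hleft, hright⟩
  refine ⟨s, hs, hs0, fun s' hs' hs0' =>
    eq_of_zero_of_deriv_pos_at_zeros hder (fun r hr hr0 => ?_) hs' hs hs0' hs0⟩
  set y := x + v + r • p with hy
  have hyQ : y ∈ zeroSurface g := hr0
  have h1 := hQ.norm_unitNormal_sub_le hR hg hg' hyQ hx
  have h2 : ‖y - x‖ ^ 2 ≤ 2 * R * h := by
    rw [show y - x = v + r • p by rw [hy]; abel, norm_sq_add_smul_of_inner_eq_zero hp1 hv, hh]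
    nlinarith [hr.1, hr.2]
  have h3 := pow_le_pow_left₀ (by positivity) h1 2
  rw [mul_pow, norm_sub_sq_real, norm_unitNormal (hg' y hyQ), ← hp, hp1] at h3
  -- `‖y - x‖² ≤ 2 R h < 2 R²`, so the unit normals at `x` and `y` differ by less than `√2` and form
  -- an acute angle.
  have h4 : 0 < inner ℝ (unitNormal g y) p := by
    by_contra hneg
    have h5 := mul_nonneg (sq_nonneg R) (sub_nonneg.2 (not_lt.1 hneg))
    nlinarith
  rw [gradient_eq_smul_unitNormal (hg' y hyQ), inner_smul_left]
  exact mul_pos (norm_pos_iff.2 (hg' y hyQ)) h4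

theorem mem_segment_sub_add_smul {z p y : EuclideanSpace ℝ (Fin n)} {h : ℝ} (h0 : 0 ≤ h) :
    y ∈ segment ℝ (z - h • p) (z + h • p) ↔ ∃ s ∈ Icc (-h) h, z + s • p = y := by
  have him := image_segment ℝ (AffineMap.lineMap z (z + p)) (-h) h
  rw [segment_eq_Icc (show -h ≤ h by linarith)] at him
  simp only [AffineMap.lineMap_apply, vsub_eq_sub, add_sub_cancel_left, vadd_eq_add,
    neg_smul] at him
  rw [sub_eq_add_neg, add_comm z, add_comm z (h • p), ← him]
  simp [AffineMap.lineMap_apply, add_comm]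

theorem inner_unitNormal_tangentGradient (x : EuclideanSpace ℝ (Fin n)) :
    inner ℝ (unitNormal g x) (tangentGradient f g x) = 0 := by
  have : tangentGradient f g x ∈ (Submodule.span ℝ {gradient g x})ᗮ :=
    Submodule.starProjection_apply_mem _ _
  rw [unitNormal, inner_smul_left, Submodule.mem_orthogonal_singleton_iff_inner_right.1 this,
    mul_zero]

theorem inner_gradient_tangentGradient (x : EuclideanSpace ℝ (Fin n)) :
    inner ℝ (gradient f x) (tangentGradient f g x) = ‖tangentGradient f g x‖ ^ 2 := by
  have h := Submodule.starProjection_inner_eq_zero (K := tangentSubspace g x) (gradient f x)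
    (tangentGradient f g x) (Submodule.starProjection_apply_mem _ _)
  rw [inner_sub_left, sub_eq_zero] at h
  rw [h, ← real_inner_self_eq_norm_sq, tangentGradient]

theorem norm_tangentGradient_le {L : ℝ≥0} (hL : LipschitzWith L f)
    (x : EuclideanSpace ℝ (Fin n)) : ‖tangentGradient f g x‖ ≤ L :=
  (Submodule.norm_starProjection_apply_le _ _).trans (norm_gradient_le_of_lipschitzWith hL x)

theorem mul_lt_two_of_lt_optimalStep {L L₁ R t : ℝ} (hL : 0 < L) (hL₁ : 0 < L₁) (hR : 0 < R)
    (ht : t < 2 * optimalStep L L₁ R) : t * (L₁ + 2 * L / R) < 2 := by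
  have hD : 0 < L₁ + 2 * L / R := by positivity
  rwa [optimalStep, mul_one_div, lt_div_iff₀ hD] at ht

theorem stepGain_pos {L L₁ R t : ℝ} (hL : 0 < L) (hL₁ : 0 < L₁) (hR : 0 < R)
    (ht : t ∈ Ioo 0 (2 * optimalStep L L₁ R)) : 0 < stepGain L L₁ R t := by
  have h1 := mul_lt_two_of_lt_optimalStep hL hL₁ hR ht.2
  have h2 : stepGain L L₁ R t = t / 2 * (2 - t * (L₁ + 2 * L / R)) := by
    rw [stepGain]; ring
  rw [h2]
  exact mul_pos (half_pos ht.1) (sub_pos.2 h1)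

theorem stepGain_optimalStep {L L₁ R : ℝ} (hL : 0 < L) (hL₁ : 0 < L₁) (hR : 0 < R) :
    stepGain L L₁ R (optimalStep L L₁ R) = optimalStep L L₁ R / 2 := by
  have hD : 0 < L₁ + 2 * L / R := by positivity
  rw [stepGain, optimalStep, show L₁ / 2 + L / R = (L₁ + 2 * L / R) / 2 by ring]
  field_simp
  ring

theorem stepGain_le {L L₁ R : ℝ} (hL : 0 < L) (hL₁ : 0 < L₁) (hR : 0 < R) (s : ℝ) :
    stepGain L L₁ R s ≤ stepGain L L₁ R (optimalStep L L₁ R) := by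
  have hD : 0 < L₁ + 2 * L / R := by positivity
  rw [stepGain_optimalStep hL hL₁ hR, stepGain, optimalStep,
    show L₁ / 2 + L / R = (L₁ + 2 * L / R) / 2 by ring]
  generalize L₁ + 2 * L / R = D at hD
  have h : 1 / D / 2 - (s - s ^ 2 * (D / 2)) = D / 2 * (s - 1 / D) ^ 2 := by
    field_simp
    ring
  have : 0 ≤ D / 2 * (s - 1 / D) ^ 2 := by positivity
  linarith

theorem exists_isGPA2Step {L L₁ : ℝ≥0} {t : ℝ} (hL : 0 < L) (hL₁ : 0 < L₁) (hR : 0 < R)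
    (hfL : LipschitzWith L f) (hf : Differentiable ℝ f) (hfL₁ : LipschitzWith L₁ (gradient f))
    (hg : ContDiff ℝ 1 g) (hg' : ∀ x ∈ zeroSurface g, gradient g x ≠ 0)
    (hQ : ProximallySmooth (zeroSurface g) R) (ht : t ∈ Ioo 0 (2 * optimalStep L L₁ R))
    {x : EuclideanSpace ℝ (Fin n)} (hx : x ∈ zeroSurface g) :
    ∃ y, IsGPA2Step f g R t x y ∧
      f y - f x ≤ -(‖tangentGradient f g x‖ ^ 2 * stepGain L L₁ R t) ∧
      ‖y - x‖ ^ 2 ≤ 2 * t ^ 2 * ‖tangentGradient f g x‖ ^ 2 := by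
  have hL' : (0 : ℝ) < L := hL
  have hL₁' : (0 : ℝ) < L₁ := hL₁
  set P := tangentGradient f g x with hP
  set p := unitNormal g x with hp
  have hp1 : ‖p‖ = 1 := norm_unitNormal (hg' x hx)
  set v := -(t • P) with hv
  have hpv : inner ℝ p v = 0 := by
    rw [hv, inner_neg_right, inner_smul_right, inner_unitNormal_tangentGradient, mul_zero, neg_zero]
  have hvn : ‖v‖ = t * ‖P‖ := by rw [hv, norm_neg, norm_smul, Real.norm_of_nonneg ht.1.le]
  have hz : tangentStep f g t x = x + v := by rw [tangentStep, hv, sub_eq_add_neg]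
  have hvR : ‖v‖ < R := by
    have h1 := mul_lt_two_of_lt_optimalStep hL' hL₁' hR ht.2
    have h2 : t * L / R < 1 := by
      have : t * (L₁ + 2 * L / R) = t * L₁ + 2 * (t * L / R) := by ring
      have := mul_pos ht.1 hL₁'
      linarith
    rw [div_lt_one hR] at h2
    rw [hvn]
    exact (mul_le_mul_of_nonneg_left (norm_tangentGradient_le hfL x) ht.1.le).trans_lt h2
  set h := halfLength f g R t x with hh
  have hh' : h = R - √(R ^ 2 - ‖v‖ ^ 2) := by
    rw [hh, halfLength, hz, sub_add_cancel_left, norm_neg]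
  have hpos : 0 < R ^ 2 - ‖v‖ ^ 2 := by nlinarith [norm_nonneg v]
  have hsq := Real.sq_sqrt hpos.le
  have hsq0 := Real.sqrt_pos.2 hpos
  have hsqR : √(R ^ 2 - ‖v‖ ^ 2) ≤ R := by
    rw [Real.sqrt_le_left hR.le]; nlinarith [norm_nonneg v]
  have h0 : 0 ≤ h := by linarith
  have hhR : h < R := by linarith
  have hhv : ‖v‖ ^ 2 = 2 * R * h - h ^ 2 := by
    have : √(R ^ 2 - ‖v‖ ^ 2) = R - h := by linarith
    rw [this] at hsq
    linarith
  -- Since `h < R`, `2 R h - h² ≥ R h`; the normal correction is of second order in the tangent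
  -- step.
  have hRh : R * h ≤ ‖v‖ ^ 2 := by nlinarith
  obtain ⟨s, hs, hs0, huniq⟩ :=
    hQ.existsUnique_zero_on_normal_segment hR hg hg' hx hpv h0 hhR hhv
  have hsabs : |s| ≤ h := abs_le.2 hs
  refine ⟨x + v + s • p, ?_, ?_, ?_⟩
  · rw [IsGPA2Step, normalSegment, hz]
    ext y
    rw [mem_inter_iff, mem_segment_sub_add_smul h0, mem_singleton_iff]
    constructor
    · rintro ⟨⟨s', hs', rfl⟩, hy⟩
      rw [huniq s' hs' hy]
    · rintro rfl
      exact ⟨⟨s, hs, rfl⟩, hs0⟩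
  · have h1 : f (x + v + s • p) - f (x + v) ≤ L * h := by
      refine (le_abs_self _).trans ?_
      have h2 := hfL.norm_sub_le (x + v + s • p) (x + v)
      rw [add_sub_cancel_left, norm_smul, hp1, mul_one] at h2
      exact h2.trans (mul_le_mul_of_nonneg_left hsabs hL'.le)
    have h2 := le_of_lipschitzWith_gradient hf hfL₁ x v
    have h3 : inner ℝ (gradient f x) v = -(t * ‖P‖ ^ 2) := by
      rw [hv, inner_neg_right, inner_smul_right, inner_gradient_tangentGradient]
    have h4 : (L : ℝ) * h ≤ L / R * ‖v‖ ^ 2 := by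
      have h5 := mul_le_mul_of_nonneg_left hRh (div_pos hL' hR).le
      have h6 : (L : ℝ) / R * (R * h) = L * h := by field_simp
      linarith
    have h5 : -(‖P‖ ^ 2 * stepGain L L₁ R t) =
        -(t * ‖P‖ ^ 2) + L₁ / 2 * ‖v‖ ^ 2 + L / R * ‖v‖ ^ 2 := by
      rw [stepGain, hvn]; ring
    rw [h5]
    linarith
  · rw [show x + v + s • p - x = v + s • p by abel, norm_sq_add_smul_of_inner_eq_zero hp1 hpv]
    have : s ^ 2 ≤ h ^ 2 := sq_le_sq' hs.1 hs.2
    have h6 : 2 * t ^ 2 * ‖P‖ ^ 2 = 2 * ‖v‖ ^ 2 := by rw [hvn]; ring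
    rw [h6]
    nlinarith

theorem IsGPA2Step.mem {t : ℝ} {x y : EuclideanSpace ℝ (Fin n)} (h : IsGPA2Step f g R t x y) :
    y ∈ zeroSurface g :=
  (h.symm.subset rfl : y ∈ normalSegment f g R t x ∩ zeroSurface g).2

theorem IsGPA2Step.unique {t : ℝ} {x y z : EuclideanSpace ℝ (Fin n)}
    (h : IsGPA2Step f g R t x y) (h' : IsGPA2Step f g R t x z) : y = z :=
  singleton_injective (h.symm.trans h')

theorem existsUnique_isGPA2Run {t : ℝ}
    (hstep : ∀ x ∈ zeroSurface g, ∃ y, IsGPA2Step f g R t x y)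
    {x₀ : EuclideanSpace ℝ (Fin n)} (hx₀ : x₀ ∈ zeroSurface g) :
    ∃! x : ℕ → EuclideanSpace ℝ (Fin n), IsGPA2Run f g R t x₀ x := by
  choose F hF using hstep
  let G : zeroSurface g → zeroSurface g := fun x => ⟨F x x.2, (hF x x.2).mem⟩
  refine ⟨fun k => (G^[k] ⟨x₀, hx₀⟩ : zeroSurface g), ⟨rfl, fun k => ?_⟩, fun y hy => ?_⟩
  · simp only [Function.iterate_succ_apply']
    exact hF _ _
  · funext k
    induction k with
    | zero => exact hy.1
    | succ k ih =>
      rw [Function.iterate_succ_apply']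
      have h := hy.2 k
      rw [ih] at h
      exact h.unique (hF _ _)

theorem exists_linear_convergence {L L₁ : ℝ≥0} {t : ℝ} (hL : 0 < L) (hL₁ : 0 < L₁) (hR : 0 < R)
    (hfL : LipschitzWith L f) (hf : Differentiable ℝ f) (hfL₁ : LipschitzWith L₁ (gradient f))
    (hg : ContDiff ℝ 1 g) (hg' : ∀ x ∈ zeroSurface g, gradient g x ≠ 0)
    (hQ : ProximallySmooth (zeroSurface g) R) (ht : t ∈ Ioo 0 (2 * optimalStep L L₁ R))
    {μ β f₀ : ℝ} (hμ : 0 < μ) (hLPL : LPLCondition f g μ β f₀) :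
    ∃ C > 0, ∃ ρ ∈ Ioo (0 : ℝ) 1, ∀ x₀ ∈ zeroSurface g, f x₀ ≤ β →
      ∀ x : ℕ → EuclideanSpace ℝ (Fin n), IsGPA2Run f g R t x₀ x →
        ∃ xmin ∈ zeroSurface g, f xmin = f₀ ∧ ∀ k, ‖x k - xmin‖ ≤ C * ρ ^ k := by
  set q := stepGain L L₁ R t with hq
  have hq0 : 0 < q := stepGain_pos hL hL₁ hR ht
  -- The maximum with `1 / 2` keeps the rate positive even when `1 - q * μ ≤ 0`; the root appears
  -- because distances scale like the square root of the gap.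
  set ρ := √(max (1 - q * μ) (1 / 2)) with hρ
  have hσ0 : 0 < max (1 - q * μ) (1 / 2) := lt_max_of_lt_right (by norm_num)
  have hσ1 : max (1 - q * μ) (1 / 2) < 1 :=
    max_lt (by linarith [mul_pos hq0 hμ]) (by norm_num)
  have hρ0 : 0 < ρ := Real.sqrt_pos.2 hσ0
  have hρ1 : ρ < 1 := by rw [hρ, Real.sqrt_lt' one_pos]; simpa using hσ1
  have hρsq : ρ ^ 2 = max (1 - q * μ) (1 / 2) := Real.sq_sqrt hσ0.le
  -- `β - f₀` bounds every initial gap, making `A` independent of `x₀`; the `1` ensures `0 < A`.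
  set A := √(2 * t ^ 2 / q * max (β - f₀) 1) with hA
  have hA0 : 0 < A := by
    have := ht.1
    have := lt_max_of_lt_right (b := β - f₀) (zero_lt_one (α := ℝ))
    rw [hA]; positivity
  have hAsq : A ^ 2 = 2 * t ^ 2 / q * max (β - f₀) 1 := Real.sq_sqrt (by positivity)
  have hρ' : 0 < 1 - ρ := sub_pos.2 hρ1
  refine ⟨A / (1 - ρ), by positivity, ρ, ⟨hρ0, hρ1⟩, fun x₀ hx₀ hβ x hx => ?_⟩
  have hmem : ∀ k, x k ∈ zeroSurface g := by
    intro k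
    cases k with
    | zero => rw [hx.1]; exact hx₀
    | succ k => exact (hx.2 k).mem
  have hmin : ∀ k, f₀ ≤ f (x k) := fun k => hLPL.1.2 (mem_image_of_mem f (hmem k))
  have hdec : ∀ k, f (x (k + 1)) - f (x k) ≤ -(‖tangentGradient f g (x k)‖ ^ 2 * q) ∧
      ‖x (k + 1) - x k‖ ^ 2 ≤ 2 * t ^ 2 * ‖tangentGradient f g (x k)‖ ^ 2 := by
    intro k
    obtain ⟨y, hy, h⟩ := exists_isGPA2Step hL hL₁ hR hfL hf hfL₁ hg hg' hQ ht (hmem k)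
    rwa [(hx.2 k).unique hy]
  have hle : ∀ k, f (x k) ≤ β := by
    intro k
    induction k with
    | zero => rwa [hx.1]
    | succ k ih =>
      have := mul_nonneg (sq_nonneg ‖tangentGradient f g (x k)‖) hq0.le
      linarith [(hdec k).1]
  have hgap : ∀ k, f (x k) - f₀ ≤ max (β - f₀) 1 * (ρ ^ 2) ^ k := by
    intro k
    induction k with
    | zero => rw [hx.1, pow_zero, mul_one]; exact (sub_le_sub_right hβ _).trans (le_max_left _ _)
    | succ k ih =>
      have h1 := mul_le_mul_of_nonneg_right (hLPL.2 (x k) (hmem k) (hle k)) hq0.le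
      have h2 : f (x (k + 1)) - f₀ ≤ (1 - q * μ) * (f (x k) - f₀) := by
        linarith [(hdec k).1]
      have h3 : (1 - q * μ) * (f (x k) - f₀) ≤ ρ ^ 2 * (f (x k) - f₀) :=
        mul_le_mul_of_nonneg_right (hρsq ▸ le_max_left _ _) (sub_nonneg.2 (hmin k))
      have h4 := mul_le_mul_of_nonneg_left ih (sq_nonneg ρ)
      calc _ ≤ _ := h2.trans (h3.trans h4)
        _ = _ := by ring
  have hstep : ∀ k, dist (x k) (x (k + 1)) ≤ A * ρ ^ k := by
    intro k
    rw [dist_comm, dist_eq_norm]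
    refine le_of_sq_le_sq ?_ (by positivity)
    -- The reverse of LPL: a step cannot decrease `f` below `f₀`.
    have h1 : ‖tangentGradient f g (x k)‖ ^ 2 ≤ (f (x k) - f₀) / q := by
      rw [le_div_iff₀ hq0]
      linarith [(hdec k).1, hmin (k + 1)]
    calc ‖x (k + 1) - x k‖ ^ 2 ≤ 2 * t ^ 2 * ‖tangentGradient f g (x k)‖ ^ 2 := (hdec k).2
      _ ≤ 2 * t ^ 2 * ((max (β - f₀) 1 * (ρ ^ 2) ^ k) / q) := by
        refine mul_le_mul_of_nonneg_left (h1.trans ?_) (by positivity)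
        exact div_le_div_of_nonneg_right (hgap k) hq0.le
      _ = (A * ρ ^ k) ^ 2 := by rw [mul_pow, hAsq]; ring
  obtain ⟨xmin, hlim⟩ := cauchySeq_tendsto_of_complete (cauchySeq_of_le_geometric ρ A hρ1 hstep)
  refine ⟨xmin, hQ.1.mem_of_tendsto hlim (Eventually.of_forall hmem), ?_, fun k => ?_⟩
  · have h1 : Tendsto (fun k => f (x k)) atTop (𝓝 (f xmin)) :=
      (hfL.continuous.tendsto xmin).comp hlim
    refine tendsto_nhds_unique h1 ?_
    have h2 : Tendsto (fun k => f₀ + max (β - f₀) 1 * (ρ ^ 2) ^ k) atTop (𝓝 f₀) := by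
      simpa using ((tendsto_pow_atTop_nhds_zero_of_lt_one (sq_nonneg ρ)
        (hρsq ▸ hσ1)).const_mul (max (β - f₀) 1)).const_add f₀
    exact tendsto_of_tendsto_of_tendsto_of_le_of_le tendsto_const_nhds h2 hmin
      fun k => by linarith [hgap k]
  · have := dist_le_of_le_geometric_of_tendsto ρ A hρ1 hstep hlim k
    rw [dist_eq_norm] at this
    calc _ ≤ _ := this
      _ = _ := by ring

end Step

end Preliminaries

theorem mainTheorem3 (n : ℕ) (f g : EuclideanSpace ℝ (Fin n) → ℝ) (L L₁ : ℝ≥0) (R t : ℝ)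
    (hL : 0 < L) (hL₁ : 0 < L₁) (hR : 0 < R)
    (hfL : LipschitzWith L f) (hf : Differentiable ℝ f) (hfL₁ : LipschitzWith L₁ (gradient f))
    (hg : ContDiff ℝ 1 g) (hg' : ∀ x ∈ zeroSurface g, gradient g x ≠ 0)
    (hQ : ProximallySmooth (zeroSurface g) R)
    (ht : t ∈ Ioo 0 (2 * optimalStep L L₁ R)) :
    -- one step is well defined and decreases `f`
    (∀ x₀ ∈ zeroSurface g, ∃ x₁, IsGPA2Step f g R t x₀ x₁ ∧
      f x₁ - f x₀ ≤ -(‖tangentGradient f g x₀‖ ^ 2 * stepGain L L₁ R t)) ∧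
    -- the function `q`
    (IsMaxOn (stepGain L L₁ R) univ (optimalStep L L₁ R) ∧
      stepGain L L₁ R (optimalStep L L₁ R) = optimalStep L L₁ R / 2 ∧
      ∀ s ∈ Ioo 0 (2 * optimalStep L L₁ R), 0 < stepGain L L₁ R s) ∧
    -- the algorithm is well defined
    (∀ x₀ ∈ zeroSurface g, ∃! x : ℕ → EuclideanSpace ℝ (Fin n), IsGPA2Run f g R t x₀ x) ∧
    -- linear convergence to a minimum point, with constants independent of the initial point
    (∀ μ β f₀ : ℝ, 0 < μ → LPLCondition f g μ β f₀ →
      ∃ C > 0, ∃ ρ ∈ Ioo (0 : ℝ) 1,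
        ∀ x₀ ∈ zeroSurface g, f x₀ ≤ β →
          ∀ x : ℕ → EuclideanSpace ℝ (Fin n), IsGPA2Run f g R t x₀ x →
            ∃ xmin ∈ zeroSurface g, f xmin = f₀ ∧ ∀ k, ‖x k - xmin‖ ≤ C * ρ ^ k) := by
  have hL' : (0 : ℝ) < L := hL
  have hL₁' : (0 : ℝ) < L₁ := hL₁
  have hstep := fun x hx =>
    exists_isGPA2Step (x := x) hL hL₁ hR hfL hf hfL₁ hg hg' hQ ht hx
  refine ⟨fun x hx => ?_, ⟨fun s _ => stepGain_le hL' hL₁' hR s,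
    stepGain_optimalStep hL' hL₁' hR, fun s hs => stepGain_pos hL' hL₁' hR hs⟩,
    fun x hx => existsUnique_isGPA2Run (fun y hy => ?_) hx, fun μ β f₀ hμ hLPL =>
    exists_linear_convergence hL hL₁ hR hfL hf hfL₁ hg hg' hQ ht hμ hLPL⟩
  · obtain ⟨y, hy, hdec, -⟩ := hstep x hx
    exact ⟨y, hy, hdec⟩
  · obtain ⟨z, hz, -⟩ := hstep y hy
    exact ⟨z, hz⟩
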